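/- All graphs are finite, simple and undirected. The \emph{fork} is the graph obtained from the claw $K_{1,3}$ by subdividing one edge once; the \emph{bull} is the graph obtained from a triangle by attaching one pendant vertex to each of two of its vertices. A graph is \emph{(fork, bull)-free} if it has no induced subgraph isomorphic to the fork or to the bull. A \emph{hole} of length $\ell \ge 5$ is an induced cycle on $\ell$ vertices. A set $S\subseteq V(G)$ is \emph{homogeneous} if every vertex of $V(G)\setminus S$ is either adjacent to all vertices of $S$ or adjacent to none of them; a \emph{module} is a homogeneous set $M$ such that every homogeneous set $S$ satisfies $S\subseteq M$, $M\subseteq S$ or $S\cap M=\emptyset$; and $G$ is \emph{prime} if its only modules are $V(G)$, $\emptyset$ and the one-element sets. A \emph{clique cutset} of a connected graph $G$ is a clique $Q$ such that the subgraph induced by $V(G)\setminus Q$ is disconnected. A coloring of $G$ is a proper vertex coloring, and it is \emph{optimal} if it uses exactly $\chi(G)$ colors. \textbf{Theorem.} Let $G$ be a prime (fork, bull)-free graph that contains no hole of length at least $6$, and suppose that $v_1$-$v_2$-$v_3$-$v_4$-$v_5$ is an induced path on five vertices ($P_5$) in $G$. Then either $G$ is connected and has a clique cutset, or there is an optimal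 coloring of $G$ in which $\{v_1,v_3,v_5\}$ is a color class (that is, the set of all vertices receiving some one color). -/

import Mathlib

namespace SimpleGraph

/-- The fork: the claw with one edge subdivided (centre `0`, leaves `1`, `2`, and the path
`0 - 3 - 4`). -/
def fork : SimpleGraph (Fin 5) :=
  fromEdgeSet {s(0, 1), s(0, 2), s(0, 3), s(3, 4)}

/-- The bull: the triangle `0, 1, 2` with a pendant vertex `3` at `0` and a pendant vertex `4`
at `1`. -/
def bull : SimpleGraph (Fin 5) :=
  fromEdgeSet {s(0, 1), s(1, 2), s(0, 2), s(0, 3), s(1, 4)}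

/-- `G` has a hole of length `n`: an induced cycle on `n ≥ 5` vertices. -/
def HasHole {V : Type*} (G : SimpleGraph V) (n : ℕ) : Prop :=
  5 ≤ n ∧ (cycleGraph n).IsIndContained G

/-- Every vertex outside `S` is complete or anticomplete to `S`. -/
def IsHomogeneousSet {V : Type*} (G : SimpleGraph V) (S : Set V) : Prop :=
  ∀ v, v ∉ S → (∀ u ∈ S, G.Adj v u) ∨ (∀ u ∈ S, ¬ G.Adj v u)

/-- A module is a homogeneous set that overlaps no homogeneous set (elsewhere also called a
strong module). -/
def IsModule {V : Type*} (G : SimpleGraph V) (M : Set V) : Prop :=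
  G.IsHomogeneousSet M ∧
    ∀ S : Set V, G.IsHomogeneousSet S → S ⊆ M ∨ M ⊆ S ∨ S ∩ M = ∅

/-- A graph is prime if all its modules are trivial: the whole vertex set, the empty set and the
one-element sets. -/
def IsPrimeGraph {V : Type*} (G : SimpleGraph V) : Prop :=
  ∀ M : Set V, G.IsModule M → M = Set.univ ∨ M = ∅ ∨ ∃ v, M = {v}

/-- A clique cutset of a connected graph: a clique whose removal leaves a disconnected graph.
(`Preconnected` holds for the graph without vertices, so the set of all vertices is never a
cutset.) -/
def IsCliqueCutset {V : Type*} (G : SimpleGraph V) (Q : Set V) : Prop :=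
  G.Connected ∧ G.IsClique Q ∧ ¬ (G.induce Qᶜ).Preconnected

end SimpleGraph

namespace SimpleGraph

variable {V : Type*} {G : SimpleGraph V}

/-- The edges of `G` with both ends in `s`, as a graph on all vertices. -/
def restrictTo (G : SimpleGraph V) (s : Set V) : SimpleGraph V where
  Adj u v := G.Adj u v ∧ u ∈ s ∧ v ∈ s
  symm := ⟨fun _ _ h => ⟨h.1.symm, h.2.2, h.2.1⟩⟩
  loopless := ⟨fun _ h => h.1.ne rfl⟩

theorem Reachable.mem_of_restrictTo {s : Set V} {u v : V}
    (h : (G.restrictTo s).Reachable u v) (hu : u ∈ s) : v ∈ s := by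
  obtain ⟨p⟩ := h
  induction p with
  | nil => exact hu
  | cons h _ ih => exact ih h.2.2

theorem Reachable.trans_adj {u v w : V} (h : G.Reachable u v) (hvw : G.Adj v w) :
    G.Reachable u w := h.trans hvw.reachable

/-- A predicate that holds at one end of a walk and fails at the other changes along an edge. -/
theorem Reachable.exists_adj_and_not {p : V → Prop} {a b : V} (h : G.Reachable a b) (ha : p a)
    (hb : ¬ p b) : ∃ u v, G.Reachable a u ∧ G.Adj u v ∧ p u ∧ ¬ p v := by
  obtain ⟨w⟩ := h
  induction w with
  | nil => exact absurd ha hb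
  | @cons a c b hac w ih =>
    by_cases hc : p c
    · obtain ⟨u, v, hu, h⟩ := ih hc hb
      exact ⟨u, v, hac.reachable.trans hu, h⟩
    · exact ⟨a, c, Reachable.refl a, hac, ha, hc⟩

/-! ### Prime graphs -/

theorem IsHomogeneousSet.compl {S : Set V} (h : G.IsHomogeneousSet S) :
    Gᶜ.IsHomogeneousSet S := by
  intro v hv
  rcases h v hv with h | h
  · exact Or.inr fun u hu => by simp [compl_adj, h u hu]
  · refine Or.inl fun u hu => ?_
    rw [compl_adj]
    exact ⟨fun e => hv (e ▸ hu), h u hu⟩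

theorem isHomogeneousSet_compl_iff {S : Set V} :
    Gᶜ.IsHomogeneousSet S ↔ G.IsHomogeneousSet S :=
  ⟨fun h => by simpa using h.compl, fun h => h.compl⟩

theorem IsPrimeGraph.compl (h : G.IsPrimeGraph) : Gᶜ.IsPrimeGraph := by
  intro M hM
  refine h M ⟨isHomogeneousSet_compl_iff.1 hM.1, fun S hS => hM.2 S hS.compl⟩

theorem isModule_setOf_reachable (a : V) : G.IsModule {v | G.Reachable a v} := by
  refine ⟨fun v hv => Or.inr fun u hu huv => hv (hu.trans_adj huv.symm), fun S hS => ?_⟩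
  by_contra! hcon
  obtain ⟨h₁, h₂, u, huS, hu⟩ := hcon
  obtain ⟨t, htS, ht⟩ := Set.not_subset.1 h₁
  obtain ⟨w, hw, hwS⟩ := Set.not_subset.1 h₂
  have huw : G.Reachable u w := Reachable.trans (Reachable.symm hu) hw
  obtain ⟨x, y, hx, hxy, hxS, hyS⟩ := huw.exists_adj_and_not (p := (· ∈ S)) huS hwS
  rcases hS y hyS with h | h
  · exact ht (((Reachable.trans hu hx).trans_adj hxy).trans_adj (h t htS))
  · exact h x hxS hxy.symm

theorem IsPrimeGraph.reachable (h : G.IsPrimeGraph) {a b : V} (hab : G.Adj a b) (x y : V) :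
    G.Reachable x y := by
  have key : {v | G.Reachable a v} = Set.univ := by
    rcases h _ (isModule_setOf_reachable a) with h | h | ⟨v, h⟩
    · exact h
    · exact absurd (Reachable.refl (G := G) a) (Set.eq_empty_iff_forall_notMem.1 h a)
    · have h₁ : a ∈ ({v} : Set V) := h ▸ Reachable.refl a
      have h₂ : b ∈ ({v} : Set V) := h ▸ hab.reachable
      exact absurd (h₁.trans h₂.symm) hab.ne
  have hr : ∀ v, G.Reachable a v := fun v => (key ▸ Set.mem_univ v : v ∈ {v | G.Reachable a v})
  exact (hr x).symm.trans (hr y)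

/-- In a prime graph that is neither complete nor edgeless, homogeneous sets are trivial. -/
theorem IsPrimeGraph.eq_univ_of_isHomogeneousSet [Finite V] (h : G.IsPrimeGraph) {a b c d : V}
    (hab : G.Adj a b) (hcd : Gᶜ.Adj c d) {S : Set V} (hS : G.IsHomogeneousSet S)
    (hn : S.Nontrivial) : S = Set.univ := by
  by_contra hne
  obtain ⟨M, hSM, hM⟩ :=
    (Set.toFinite {M : Set V | G.IsHomogeneousSet M ∧ M ≠ Set.univ}).exists_le_maximal
      (a := S) ⟨hS, hne⟩
  have hmod : G.IsModule M := by
    refine ⟨hM.prop.1, fun T hT => ?_⟩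
    by_contra! hcon
    obtain ⟨h₁, h₂, u, huT, huM⟩ := hcon
    obtain ⟨t, htT, htM⟩ := Set.not_subset.1 h₁
    obtain ⟨w, hwM, hwT⟩ := Set.not_subset.1 h₂
    have hunion : M ∪ T = Set.univ := by
      by_contra hU
      refine htM (hM.le_of_ge (y := M ∪ T) ⟨fun v hv => ?_, hU⟩ Set.subset_union_left (Or.inr htT))
      rw [Set.mem_union, not_or] at hv
      rcases hM.prop.1 v hv.1 with h | h <;> rcases hT v hv.2 with h' | h'
      · exact Or.inl fun x hx => hx.elim (h x) (h' x)
      · exact absurd (h u huM) (h' u huT)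
      · exact absurd (h' u huT) (h u huM)
      · exact Or.inr fun x hx => hx.elim (h x) (h' x)
    have hmem : ∀ v, v ∉ T → v ∈ M := fun v hv =>
      ((hunion ▸ Set.mem_univ v : v ∈ M ∪ T)).resolve_right hv
    rcases hM.prop.1 t htM with h' | h'
    · obtain ⟨x, y, -, hxy, hx, hy⟩ :=
        (h.compl.reachable hcd u w).exists_adj_and_not (p := (· ∈ T)) huT hwT
      rcases hT y hy with h'' | h''
      · exact (compl_adj _ _ _ |>.1 hxy).2 (h'' x hx).symm
      · exact h'' t htT (h' y (hmem y hy)).symm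
    · obtain ⟨x, y, -, hxy, hx, hy⟩ :=
        (h.reachable hab u w).exists_adj_and_not (p := (· ∈ T)) huT hwT
      rcases hT y hy with h'' | h''
      · exact h' y (hmem y hy) (h'' t htT).symm
      · exact h'' x hx hxy.symm
  rcases h M hmod with h' | h' | ⟨v, h'⟩
  · exact hM.prop.2 h'
  · exact hn.nonempty.ne_empty (Set.subset_empty_iff.1 (h' ▸ hSM))
  · exact Set.not_nontrivial_singleton (hn.mono (h' ▸ hSM : S ⊆ {v}))

/-! ### Induced subgraphs -/

theorem isIndContained_of_lt {n : ℕ} {H : SimpleGraph (Fin n)} (f : Fin n → V)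
    (hf : ∀ i j, i < j → f i ≠ f j ∧ (G.Adj (f i) (f j) ↔ H.Adj i j)) : H.IsIndContained G := by
  refine ⟨⟨⟨f, fun i j hij => ?_⟩, fun {i j} => ?_⟩⟩
  · by_contra hne
    rcases lt_or_gt_of_ne hne with h | h
    · exact (hf i j h).1 hij
    · exact (hf j i h).1 hij.symm
  · rcases lt_trichotomy i j with h | rfl | h
    · exact (hf i j h).2
    · simp
    · exact (G.adj_comm _ _).trans ((hf j i h).2.trans (H.adj_comm _ _))

theorem fork_isIndContained {c l₁ l₂ m e : V} (h₁ : G.Adj c l₁) (h₂ : G.Adj c l₂)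
    (h₃ : G.Adj c m) (h₄ : G.Adj m e) (h₅ : l₁ ≠ l₂) (h₆ : ¬ G.Adj l₁ l₂) (h₇ : ¬ G.Adj l₁ m)
    (h₈ : ¬ G.Adj l₂ m) (h₉ : ¬ G.Adj c e) (h₁₀ : ¬ G.Adj l₁ e) (h₁₁ : ¬ G.Adj l₂ e) :
    fork.IsIndContained G := by
  refine isIndContained_of_lt ![c, l₁, l₂, m, e] fun i j hij => ?_
  have n₁ : c ≠ e := by rintro rfl; exact h₁₀ h₁.symm
  have n₂ : l₁ ≠ m := by rintro rfl; exact h₁₀ h₄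
  have n₃ : l₂ ≠ m := by rintro rfl; exact h₁₁ h₄
  have n₄ : l₁ ≠ e := by rintro rfl; exact h₉ h₁
  have n₅ : l₂ ≠ e := by rintro rfl; exact h₉ h₂
  fin_cases i <;> fin_cases j <;>
    first
    | exact absurd hij (by decide)
    | simp_all [fork, h₁.ne, h₂.ne, h₃.ne, h₄.ne]

theorem bull_isIndContained {a b c d e : V} (h₁ : G.Adj a b) (h₂ : G.Adj b c) (h₃ : G.Adj a c)
    (h₄ : G.Adj a d) (h₅ : G.Adj b e) (h₆ : ¬ G.Adj b d) (h₇ : ¬ G.Adj c d) (h₈ : ¬ G.Adj a e)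
    (h₉ : ¬ G.Adj c e) (h₁₀ : ¬ G.Adj d e) : bull.IsIndContained G := by
  refine isIndContained_of_lt ![a, b, c, d, e] fun i j hij => ?_
  have n₁ : a ≠ e := by rintro rfl; exact h₁₀ h₄.symm
  have n₂ : b ≠ d := by rintro rfl; exact h₁₀ h₅
  have n₃ : c ≠ d := by rintro rfl; exact h₆ h₂
  have n₄ : c ≠ e := by rintro rfl; exact h₈ h₃
  have n₅ : d ≠ e := by rintro rfl; exact h₈ h₄
  fin_cases i <;> fin_cases j <;>
    first
    | exact absurd hij (by decide)
    | simp_all [bull, h₁.ne, h₂.ne, h₃.ne, h₄.ne, h₅.ne]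

theorem cycleGraph_adj_of_lt {n : ℕ} {i j : Fin n} (h : i < j) :
    (cycleGraph n).Adj i j ↔ j.val = i.val + 1 ∨ (i.val = 0 ∧ j.val + 1 = n) := by
  rw [cycleGraph_adj']
  have h' : i.val < j.val := h
  have hj := j.isLt
  rw [Fin.sub_val_of_le h.le, Fin.val_sub]
  have : (n - j.val + i.val) % n = n - j.val + i.val := Nat.mod_eq_of_lt (by omega)
  omega

/-- `a - b - c - d - e` is an induced path. -/
structure IsP5 (G : SimpleGraph V) (a b c d e : V) : Prop where
  ab : G.Adj a b
  bc : G.Adj b c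
  cd : G.Adj c d
  de : G.Adj d e
  ac : ¬ G.Adj a c
  ad : ¬ G.Adj a d
  ae : ¬ G.Adj a e
  bd : ¬ G.Adj b d
  be : ¬ G.Adj b e
  ce : ¬ G.Adj c e

theorem IsP5.reverse {a b c d e : V} (h : G.IsP5 a b c d e) : G.IsP5 e d c b a :=
  ⟨h.de.symm, h.cd.symm, h.bc.symm, h.ab.symm, fun t => h.ce t.symm, fun t => h.be t.symm,
    fun t => h.ae t.symm, fun t => h.bd t.symm, fun t => h.ad t.symm, fun t => h.ac t.symm⟩

/-- The ends of the path `a - b - c - d - e` and all vertices away from its interior. -/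
def awayFrom (G : SimpleGraph V) (a b c d e : V) : Set V :=
  {u | u = a ∨ u = e ∨ (¬ G.Adj u b ∧ ¬ G.Adj u c ∧ ¬ G.Adj u d)}

/-- If the ends of an induced path on five vertices can be joined away from its interior, then a
shortest such connection closes the path to a hole of length at least six. -/
theorem IsP5.exists_hasHole {a b c d e : V} (h : G.IsP5 a b c d e)
    (hr : (G.restrictTo (G.awayFrom a b c d e)).Reachable a e) : ∃ n, 6 ≤ n ∧ G.HasHole n := by
  obtain ⟨p, hp⟩ := hr.exists_walk_length_eq_dist
  have hpath := p.isPath_of_length_eq_dist hp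
  have hae : a ≠ e := by rintro rfl; exact h.be h.ab.symm
  have hlen : 1 < p.length := hp ▸ hr.one_lt_dist_of_ne_of_not_adj hae fun t => h.ae t.1
  have hmem : ∀ i, p.getVert i ∈ G.awayFrom a b c d e := fun i =>
    Reachable.mem_of_restrictTo ⟨p.take i⟩ (Or.inl rfl)
  have hinj : ∀ i j, i < j → j ≤ p.length → p.getVert i ≠ p.getVert j := fun i j hij hj hne =>
    hij.ne (hpath.getVert_injOn (show i ≤ p.length by omega) hj hne)
  have hadj : ∀ i j, i < j → j ≤ p.length →
      (G.Adj (p.getVert i) (p.getVert j) ↔ j = i + 1) := by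
    intro i j hij hj
    constructor
    · intro hG
      have hH : (G.restrictTo (G.awayFrom a b c d e)).Adj (p.getVert i) (p.getVert j) :=
        ⟨hG, hmem i, hmem j⟩
      have := dist_le ((p.take i).append (Walk.cons hH (p.drop j)))
      rw [← hp, Walk.length_append, Walk.length_cons, Walk.take_length, Walk.drop_length] at this
      omega
    · rintro rfl
      exact (p.adj_getVert_succ hj).1
  have had : a ≠ d := by rintro rfl; exact h.ac h.cd.symm
  have hac : a ≠ c := by rintro rfl; exact h.ad h.cd
  have hec : e ≠ c := by rintro rfl; exact h.be h.bc
  have heb : e ≠ b := by rintro rfl; exact h.ae h.ab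
  have hb : ∀ i ≤ p.length, p.getVert i ≠ b ∧ (G.Adj (p.getVert i) b ↔ i = 0) := by
    intro i hi
    rw [← hpath.getVert_eq_start_iff hi]
    rcases hmem i with h1 | h1 | h1
    · simp [h1, h.ab, h.ab.ne]
    · simp [h1, hae.symm, heb, h.reverse.ad]
    · exact ⟨fun t => h1.2.1 (t.symm ▸ h.bc), fun t => absurd t h1.1, fun t => t.symm ▸ h.ab⟩
  have hc : ∀ i ≤ p.length, p.getVert i ≠ c ∧ ¬ G.Adj (p.getVert i) c := by
    intro i hi
    rcases hmem i with h1 | h1 | h1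
    · simp [h1, h.ac, hac]
    · simp [h1, hec, h.reverse.ac]
    · exact ⟨fun t => h1.2.2 (t.symm ▸ h.cd), h1.2.1⟩
  have hd : ∀ i ≤ p.length, p.getVert i ≠ d ∧ (G.Adj (p.getVert i) d ↔ i = p.length) := by
    intro i hi
    rw [← hpath.getVert_eq_end_iff hi]
    rcases hmem i with h1 | h1 | h1
    · simp [h1, h.ad, had, hae]
    · simp [h1, h.de.symm, h.de.ne']
    · exact ⟨fun t => h1.2.1 (t.symm ▸ h.cd.symm), fun t => absurd t h1.2.2,
        fun t => t.symm ▸ h.de.symm⟩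
  have hbd : b ≠ d := by rintro rfl; exact h.ad h.ab
  refine ⟨p.length + 4, by omega, by omega, isIndContained_of_lt
    (fun i => if i.val ≤ p.length then p.getVert i.val else if i.val = p.length + 1 then d
      else if i.val = p.length + 2 then c else b) fun i j hij => ?_⟩
  rw [cycleGraph_adj_of_lt hij]
  have hi := i.isLt
  have hj := j.isLt
  have hlt : i.val < j.val := hij
  generalize i.val = i at *
  generalize j.val = j at *
  by_cases h1 : j ≤ p.length
  · simp only [if_pos h1, if_pos (show i ≤ p.length by omega)]
    exact ⟨hinj i j hlt h1, (hadj i j hlt h1).trans (by omega)⟩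
  · have hj' : j = p.length + 1 ∨ j = p.length + 2 ∨ j = p.length + 3 := by omega
    by_cases h2 : i ≤ p.length
    · obtain ⟨b1, b2⟩ := hb i h2
      obtain ⟨c1, c2⟩ := hc i h2
      obtain ⟨d1, d2⟩ := hd i h2
      rcases hj' with rfl | rfl | rfl
      · simp [h2, d1, d2]; omega
      · simp [h2, c1, c2]; omega
      · simp [h2, b1, b2]; omega
    · have hi' : i = p.length + 1 ∨ i = p.length + 2 := by omega
      rcases hi' with rfl | rfl <;> rcases hj' with rfl | rfl | rfl <;>
        simp [h.cd.symm, h.cd.ne', h.bc.symm, h.bc.ne', hbd.symm, h.reverse.bd] at hlt ⊢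

/-- Connected graphs without the fork, the bull, long holes and nontrivial homogeneous sets. -/
structure IsBasic (G : SimpleGraph V) : Prop where
  fork_free : ∀ {c l₁ l₂ m e : V}, G.Adj c l₁ → G.Adj c l₂ → G.Adj c m → G.Adj m e → l₁ ≠ l₂ →
    ¬ G.Adj l₁ l₂ → ¬ G.Adj l₁ m → ¬ G.Adj l₂ m → ¬ G.Adj c e → ¬ G.Adj l₁ e → ¬ G.Adj l₂ e → False
  bull_free : ∀ {a b c d e : V}, G.Adj a b → G.Adj b c → G.Adj a c → G.Adj a d → G.Adj b e →
    ¬ G.Adj b d → ¬ G.Adj c d → ¬ G.Adj a e → ¬ G.Adj c e → ¬ G.Adj d e → False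
  not_reachable : ∀ {a b c d e : V}, G.IsP5 a b c d e →
    ¬ (G.restrictTo (G.awayFrom a b c d e)).Reachable a e
  connected : G.Connected
  eq_univ : ∀ {S : Set V}, G.IsHomogeneousSet S → S.Nontrivial → S = Set.univ

theorem IsBasic.not_adj_ends (hG : G.IsBasic) {a b c d e x : V} (h : G.IsP5 a b c d e)
    (hb : ¬ G.Adj x b) (hc : ¬ G.Adj x c) (hd : ¬ G.Adj x d) (ha : G.Adj x a) : ¬ G.Adj x e := by
  intro he
  have hx : x ∈ G.awayFrom a b c d e := Or.inr (Or.inr ⟨hb, hc, hd⟩)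
  have h1 : (G.restrictTo (G.awayFrom a b c d e)).Adj a x := ⟨ha.symm, Or.inl rfl, hx⟩
  exact hG.not_reachable h (h1.reachable.trans_adj ⟨he, hx, Or.inr (Or.inl rfl)⟩)

/-- The possible neighbourhoods of a vertex on an induced path on five vertices. -/
theorem IsBasic.pattern (hG : G.IsBasic) {a b c d e : V} (h : G.IsP5 a b c d e) (x : V)
    (xa : x ≠ a) (xb : x ≠ b) (xd : x ≠ d) (xe : x ≠ e) :
    (¬ G.Adj x a ∧ ¬ G.Adj x b ∧ ¬ G.Adj x c ∧ ¬ G.Adj x d ∧ ¬ G.Adj x e) ∨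
    (G.Adj x a ∧ ¬ G.Adj x b ∧ ¬ G.Adj x c ∧ ¬ G.Adj x d ∧ ¬ G.Adj x e) ∨
    (¬ G.Adj x a ∧ ¬ G.Adj x b ∧ ¬ G.Adj x c ∧ ¬ G.Adj x d ∧ G.Adj x e) ∨
    (G.Adj x a ∧ G.Adj x b ∧ ¬ G.Adj x c ∧ ¬ G.Adj x d ∧ ¬ G.Adj x e) ∨
    (¬ G.Adj x a ∧ ¬ G.Adj x b ∧ ¬ G.Adj x c ∧ G.Adj x d ∧ G.Adj x e) ∨
    (¬ G.Adj x a ∧ G.Adj x b ∧ ¬ G.Adj x c ∧ G.Adj x d ∧ ¬ G.Adj x e) ∨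
    (¬ G.Adj x a ∧ G.Adj x b ∧ G.Adj x c ∧ G.Adj x d ∧ ¬ G.Adj x e) ∨
    (G.Adj x a ∧ G.Adj x b ∧ G.Adj x c ∧ ¬ G.Adj x d ∧ ¬ G.Adj x e) ∨
    (¬ G.Adj x a ∧ ¬ G.Adj x b ∧ G.Adj x c ∧ G.Adj x d ∧ G.Adj x e) ∨
    (G.Adj x a ∧ ¬ G.Adj x b ∧ G.Adj x c ∧ ¬ G.Adj x d ∧ G.Adj x e) ∨
    (G.Adj x a ∧ G.Adj x b ∧ G.Adj x c ∧ ¬ G.Adj x d ∧ G.Adj x e) ∨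
    (G.Adj x a ∧ ¬ G.Adj x b ∧ G.Adj x c ∧ G.Adj x d ∧ G.Adj x e) ∨
    (G.Adj x a ∧ G.Adj x b ∧ G.Adj x c ∧ G.Adj x d ∧ G.Adj x e) := by
  have hh := hG.not_adj_ends h (x := x)
  -- the forks centred at the inner vertices and the bulls that rule out the other patterns
  have f1 := hG.fork_free (c := b) (l₁ := a) (l₂ := x) (m := c) (e := d)
  have f2 := hG.fork_free (c := d) (l₁ := e) (l₂ := x) (m := c) (e := b)
  have f3 := hG.fork_free (c := c) (l₁ := x) (l₂ := b) (m := d) (e := e)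
  have f4 := hG.fork_free (c := c) (l₁ := x) (l₂ := d) (m := b) (e := a)
  have f5 := hG.fork_free (c := d) (l₁ := c) (l₂ := e) (m := x) (e := a)
  have f6 := hG.fork_free (c := b) (l₁ := c) (l₂ := a) (m := x) (e := e)
  have b1 := hG.bull_free (a := b) (b := c) (c := x) (d := a) (e := d)
  have b2 := hG.bull_free (a := d) (b := c) (c := x) (d := e) (e := b)
  have b3 := hG.bull_free (a := x) (b := b) (c := a) (d := e) (e := c)
  have b4 := hG.bull_free (a := x) (b := d) (c := e) (d := a) (e := c)
  have b5 := hG.bull_free (a := x) (b := d) (c := c) (d := a) (e := e)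
  have b6 := hG.bull_free (a := x) (b := b) (c := c) (d := e) (e := a)
  have b7 := hG.bull_free (a := x) (b := d) (c := e) (d := b) (e := c)
  obtain ⟨h1, h2, h3, h4, h5, h6, h7, h8, h9, h10⟩ := h
  by_cases x1 : G.Adj x a <;> by_cases x2 : G.Adj x b <;> by_cases x3 : G.Adj x c <;>
    by_cases x4 : G.Adj x d <;> by_cases x5 : G.Adj x e <;>
    simp only [x1, x2, x3, x4, x5, not_true, not_false_iff, and_true, and_false, or_true,
      or_false] <;>
    grind [adj_comm]

/-- A vertex that is not constant on a set joined up by `H` distinguishes the ends of an edge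
of `H`. -/
theorem exists_adj_not_adj_of_reachable {H : SimpleGraph V} {r y : V}
    (h : ¬ ((∀ u ∈ {u | H.Reachable r u}, G.Adj y u) ∨ ∀ u ∈ {u | H.Reachable r u}, ¬ G.Adj y u)) :
    ∃ u v, H.Reachable r u ∧ H.Reachable r v ∧ H.Adj u v ∧ G.Adj y u ∧ ¬ G.Adj y v := by
  push Not at h
  obtain ⟨⟨s, hs, hys⟩, t, ht, hyt⟩ := h
  obtain ⟨u, v, hu, huv, h1, h2⟩ :=
    (Reachable.trans (Reachable.symm ht) hs).exists_adj_and_not (p := G.Adj y) hyt hys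
  exact ⟨u, v, Reachable.trans ht hu, (Reachable.trans ht hu).trans_adj huv, huv, h1, h2⟩

/-- No vertex has the same neighbours as `c` on `a - b - c - d - e`. -/
theorem IsBasic.no_false_twin (hG : G.IsBasic) {a b c d e x : V} (h : G.IsP5 a b c d e)
    (xc : x ≠ c) (hb : G.Adj x b) (hd : G.Adj x d) (ha : ¬ G.Adj x a) (hc : ¬ G.Adj x c)
    (he : ¬ G.Adj x e) : False := by
  let M : Set V := {u | G.Adj u b ∧ G.Adj u d ∧ ¬ G.Adj u a ∧ ¬ G.Adj u e}
  have hcM : c ∈ M := ⟨h.bc.symm, h.cd, h.reverse.ce, h.ce⟩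
  have hxM : x ∈ M := ⟨hb, hd, ha, he⟩
  let H := Gᶜ.restrictTo M
  have hcx : H.Adj c x := ⟨⟨xc.symm, fun t => hc t.symm⟩, hcM, hxM⟩
  have hhom : G.IsHomogeneousSet {u | H.Reachable c u} := by
    intro y hy
    by_contra hcon
    obtain ⟨u, v, hu, hv, huv, yu, yv⟩ := exists_adj_not_adj_of_reachable hcon
    obtain ⟨⟨-, huv⟩, ⟨ub, ud, ua, ue⟩, vM⟩ := huv
    have hyM : y ∉ M := fun hyM => hy (hv.trans_adj
      ⟨⟨fun t => hy (t ▸ hv), fun t => yv t.symm⟩, vM, hyM⟩)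
    obtain ⟨vb, vd, va, ve⟩ := vM
    have ya : y ≠ a := by rintro rfl; exact ua yu.symm
    have ye : y ≠ e := by rintro rfl; exact ue yu.symm
    have yb : y ≠ b := by rintro rfl; exact yv vb.symm
    have yd : y ≠ d := by rintro rfl; exact yv vd.symm
    have hu5 : G.IsP5 a b u d e :=
      ⟨h.ab, ub.symm, ud, h.de, fun t => ua t.symm, h.ad, h.ae, h.bd, h.be, ue⟩
    have hv5 : G.IsP5 a b v d e :=
      ⟨h.ab, vb.symm, vd, h.de, fun t => va t.symm, h.ad, h.ae, h.bd, h.be, ve⟩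
    have p1 := hG.pattern hu5 y ya yb yd ye
    have p2 := hG.pattern hv5 y ya yb yd ye
    have f1 := hG.fork_free (c := d) (l₁ := v) (l₂ := e) (m := u) (e := y)
    have f2 := hG.fork_free (c := b) (l₁ := v) (l₂ := a) (m := u) (e := y)
    have nva : v ≠ a := by rintro rfl; exact h.ad vd
    have nve : v ≠ e := by rintro rfl; exact h.be vb.symm
    have hyM' : ¬ (G.Adj y b ∧ G.Adj y d ∧ ¬ G.Adj y a ∧ ¬ G.Adj y e) := hyM
    simp only [yu, yv, not_true, not_false_iff, true_and, and_false, false_and,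
      or_false, false_or] at p1 p2
    have hyb : (G.Adj y b ∧ G.Adj y a ∧ ¬ G.Adj y d ∧ ¬ G.Adj y e) ∨
        (G.Adj y d ∧ G.Adj y e ∧ ¬ G.Adj y b ∧ ¬ G.Adj y a) := by
      clear f1 f2
      grind (splits := 30)
    have hvu : ¬ G.Adj v u := fun t => huv t.symm
    rcases hyb with ⟨h1, h2, h3, h4⟩ | ⟨h1, h2, h3, h4⟩
    · exact f1 vd.symm h.de ud.symm yu.symm nve ve hvu (fun t => ue t.symm) (fun t => h3 t.symm)
        (fun t => yv t.symm) (fun t => h4 t.symm)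
    · exact f2 vb.symm h.ab.symm ub.symm yu.symm nva va hvu (fun t => ua t.symm)
        (fun t => h3 t.symm) (fun t => yv t.symm) (fun t => h4 t.symm)
  have huniv := hG.eq_univ hhom ⟨c, Reachable.refl c, x, hcx.reachable, xc.symm⟩
  have hH : a ∈ {u | H.Reachable c u} := huniv ▸ Set.mem_univ a
  exact h.ad (Reachable.mem_of_restrictTo hH hcM).2.1

/-- A vertex with exactly the neighbours `a` and `b` on `a - b - c - d - e` gives rise to an
induced path on six vertices. -/
theorem IsBasic.exists_extension (hG : G.IsBasic) {a b c d e y : V} (h : G.IsP5 a b c d e)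
    (ha : G.Adj y a) (hb : G.Adj y b) (hc : ¬ G.Adj y c) (hd : ¬ G.Adj y d) (he : ¬ G.Adj y e) :
    ∃ s w, G.IsP5 s b c d e ∧ G.Adj w s ∧ ¬ G.Adj w b ∧ ¬ G.Adj w c ∧ ¬ G.Adj w d ∧
      ¬ G.Adj w e := by
  by_contra hcon
  push Not at hcon
  let S : Set V := {u | G.Adj u b ∧ ¬ G.Adj u c ∧ ¬ G.Adj u d ∧ ¬ G.Adj u e}
  have hhom : G.IsHomogeneousSet S := by
    intro w hw
    by_contra hw'
    push Not at hw'
    obtain ⟨⟨t, ⟨tb, tc, td, te⟩, wt⟩, s, ⟨sb, sc, sd, se⟩, ws⟩ := hw'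
    have hst : G.Adj s t := by
      by_contra hst
      exact hG.fork_free sb.symm tb.symm h.bc h.cd (by rintro rfl; exact wt ws) hst sc tc h.bd sd td
    have hs5 : G.IsP5 s b c d e := ⟨sb, h.bc, h.cd, h.de, sc, sd, se, h.bd, h.be, h.ce⟩
    have ht5 : G.IsP5 t b c d e := ⟨tb, h.bc, h.cd, h.de, tc, td, te, h.bd, h.be, h.ce⟩
    have nws : w ≠ s := ws.ne
    have nwt : w ≠ t := by rintro rfl; exact hw ⟨tb, tc, td, te⟩
    have nwb : w ≠ b := by rintro rfl; exact wt tb.symm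
    have nwd : w ≠ d := by rintro rfl; exact sd ws.symm
    have nwe : w ≠ e := by rintro rfl; exact se ws.symm
    have p1 := hG.pattern hs5 w nws nwb nwd nwe
    have p2 := hG.pattern ht5 w nwt nwb nwd nwe
    have hw1 := hcon s w hs5 ws
    have nce : c ≠ e := by rintro rfl; exact h.be h.bc
    have f1 := hG.fork_free (c := w) (l₁ := c) (l₂ := e) (m := s) (e := t)
    simp only [ws, wt, not_true, not_false_iff, true_and, false_and,
      or_false, false_or] at p1 p2
    have : G.Adj w c ∧ G.Adj w e := by
      clear f1
      grind (splits := 30)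
    exact f1 this.1 this.2 ws hst nce h.ce (fun q => sc q.symm) (fun q => se q.symm) wt
      (fun q => tc q.symm) (fun q => te q.symm)
  have huniv := hG.eq_univ hhom
    ⟨a, ⟨h.ab, h.ac, h.ad, h.ae⟩, y, ⟨hb, hc, hd, he⟩, ha.ne'⟩
  have hd' : d ∈ S := huniv ▸ Set.mem_univ d
  exact hd'.2.2.2 h.de

/-- A neighbour of a vertex away from `a - b - c - d - e` sees all of the path, an end of it only,
or nothing. -/
theorem IsBasic.pattern_of_adj_away (hG : G.IsBasic) {a b c d e z u : V} (h : G.IsP5 a b c d e)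
    (za : ¬ G.Adj z a) (zb : ¬ G.Adj z b) (zc : ¬ G.Adj z c) (zd : ¬ G.Adj z d)
    (ze : ¬ G.Adj z e) (hzu : G.Adj z u) :
    (¬ G.Adj u b ∧ ¬ G.Adj u c ∧ ¬ G.Adj u d) ∨
    (G.Adj u a ∧ G.Adj u b ∧ G.Adj u c ∧ G.Adj u d ∧ G.Adj u e) := by
  have p := hG.pattern h u (by rintro rfl; exact za hzu) (by rintro rfl; exact zb hzu)
    (by rintro rfl; exact zd hzu) (by rintro rfl; exact ze hzu)
  have nza : z ≠ a := by rintro rfl; exact zb h.ab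
  have nzd : z ≠ d := by rintro rfl; exact ze h.de
  have nze : z ≠ e := by rintro rfl; exact zd h.de.symm
  have b1 := hG.bull_free (a := u) (b := b) (c := a) (d := z) (e := c)
  have b2 := hG.bull_free (a := u) (b := d) (c := e) (d := z) (e := c)
  have b3 := hG.bull_free (a := u) (b := c) (c := b) (d := z) (e := d)
  have b4 := hG.bull_free (a := u) (b := c) (c := d) (d := z) (e := b)
  have f1 := hG.fork_free (c := u) (l₁ := z) (l₂ := d) (m := b) (e := a)
  have f2 := hG.fork_free (c := u) (l₁ := z) (l₂ := e) (m := a) (e := b)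
  have f3 := hG.fork_free (c := u) (l₁ := z) (l₂ := a) (m := e) (e := d)
  obtain ⟨h1, h2, h3, h4, h5, h6, h7, h8, h9, h10⟩ := h
  rcases p with ⟨x1, x2, x3, x4, x5⟩ | ⟨x1, x2, x3, x4, x5⟩ | ⟨x1, x2, x3, x4, x5⟩ |
    ⟨x1, x2, x3, x4, x5⟩ | ⟨x1, x2, x3, x4, x5⟩ | ⟨x1, x2, x3, x4, x5⟩ | ⟨x1, x2, x3, x4, x5⟩ |
    ⟨x1, x2, x3, x4, x5⟩ | ⟨x1, x2, x3, x4, x5⟩ | ⟨x1, x2, x3, x4, x5⟩ | ⟨x1, x2, x3, x4, x5⟩ |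
    ⟨x1, x2, x3, x4, x5⟩ | ⟨x1, x2, x3, x4, x5⟩ <;> grind [adj_comm]

/-- If some vertex is away from `a - b - c - d - e`, then some vertex extends this path. -/
theorem IsBasic.exists_end_of_away (hG : G.IsBasic) {a b c d e z : V} (h : G.IsP5 a b c d e)
    (za : ¬ G.Adj z a) (zb : ¬ G.Adj z b) (zc : ¬ G.Adj z c) (zd : ¬ G.Adj z d)
    (ze : ¬ G.Adj z e) :
    ∃ x, ¬ G.Adj x b ∧ ¬ G.Adj x c ∧ ¬ G.Adj x d ∧
      ((G.Adj x a ∧ ¬ G.Adj x e) ∨ (¬ G.Adj x a ∧ G.Adj x e)) := by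
  by_contra hcon
  push Not at hcon
  let Z : Set V := {u | ¬ G.Adj u a ∧ ¬ G.Adj u b ∧ ¬ G.Adj u c ∧ ¬ G.Adj u d ∧ ¬ G.Adj u e}
  let K : Set V := {k | k ∉ Z ∧ ∃ z ∈ Z, G.Adj z k}
  have hK : ∀ k ∈ K, G.Adj k a ∧ G.Adj k b ∧ G.Adj k c ∧ G.Adj k d ∧ G.Adj k e := by
    rintro k ⟨hkZ, z, ⟨z1, z2, z3, z4, z5⟩, hzk⟩
    rcases hG.pattern_of_adj_away h z1 z2 z3 z4 z5 hzk with h' | h'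
    · have h1 := hcon k h'.1 h'.2.1 h'.2.2
      have h2 := hG.not_adj_ends h h'.1 h'.2.1 h'.2.2
      exact absurd ⟨by tauto, h'.1, h'.2.1, h'.2.2, by tauto⟩ hkZ
    · exact h'
  let U : Set V := {u | u ∉ Z ∧ u ∉ K ∧ ∀ k ∈ K, G.Adj k u}
  have haU : a ∈ U :=
    ⟨fun t => t.2.1 h.ab, fun t => (hK a t).1.ne rfl, fun k hk => (hK k hk).1⟩
  have hbU : b ∈ U :=
    ⟨fun t => t.1 h.ab.symm, fun t => (hK b t).2.1.ne rfl, fun k hk => (hK k hk).2.1⟩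
  have hZ : ∀ z ∈ Z, ∀ u, u ∉ Z → u ∉ K → ¬ G.Adj z u := fun z hz u hu huK hzu =>
    huK ⟨hu, z, hz, hzu⟩
  let H := G.restrictTo U
  have hhom : G.IsHomogeneousSet {u | H.Reachable a u} := by
    intro y hy
    by_contra hcon'
    obtain ⟨u, v, hu, hv, huv, yu, yv⟩ := exists_adj_not_adj_of_reachable hcon'
    obtain ⟨huv, huU, hvU⟩ := huv
    have hyZ : y ∉ Z := fun t => hZ y t u huU.1 huU.2.1 yu
    have hyK : y ∉ K := fun t => yv (hvU.2.2 y t)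
    have hyU : y ∉ U := fun t => hy (hu.trans_adj ⟨yu.symm, huU, t⟩)
    have : ∃ k ∈ K, ¬ G.Adj k y := by
      by_contra! hall
      exact hyU ⟨hyZ, hyK, hall⟩
    obtain ⟨k, hk, hky⟩ := this
    obtain ⟨-, z, hz, hzk⟩ := id hk
    exact hG.bull_free (huU.2.2 k hk) huv (hvU.2.2 k hk) hzk.symm yu.symm
      (fun t => hZ z hz u huU.1 huU.2.1 t.symm) (fun t => hZ z hz v hvU.1 hvU.2.1 t.symm) hky
      (fun t => yv t.symm) (hZ z hz y hyZ hyK)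
  have huniv := hG.eq_univ hhom ⟨a, Reachable.refl a, b,
    (show H.Adj a b from ⟨h.ab, haU, hbU⟩).reachable, h.ab.ne⟩
  have hH : z ∈ {u | H.Reachable a u} := huniv ▸ Set.mem_univ z
  exact (Reachable.mem_of_restrictTo hH haU).1 ⟨za, zb, zc, zd, ze⟩

/-- The possible neighbourhoods of a further vertex on `a - b - c - d - e` if that path extends to
an induced path `x - a - b - c - d - e`. -/
theorem IsBasic.pattern_of_extension (hG : G.IsBasic) {a b c d e x : V} (h : G.IsP5 a b c d e)
    (hx : G.IsP5 x a b c d) (hxe : ¬ G.Adj x e) (y : V) (ya : y ≠ a) (yb : y ≠ b) (yc : y ≠ c)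
    (yd : y ≠ d) (ye : y ≠ e) :
    (¬ G.Adj y a ∧ ¬ G.Adj y b ∧ ¬ G.Adj y c ∧ ¬ G.Adj y d ∧ ¬ G.Adj y e) ∨
    (G.Adj y a ∧ ¬ G.Adj y b ∧ ¬ G.Adj y c ∧ ¬ G.Adj y d ∧ ¬ G.Adj y e) ∨
    (¬ G.Adj y a ∧ ¬ G.Adj y b ∧ ¬ G.Adj y c ∧ ¬ G.Adj y d ∧ G.Adj y e) ∨
    (G.Adj y a ∧ G.Adj y b ∧ ¬ G.Adj y c ∧ ¬ G.Adj y d ∧ ¬ G.Adj y e) ∨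
    (¬ G.Adj y a ∧ ¬ G.Adj y b ∧ ¬ G.Adj y c ∧ G.Adj y d ∧ G.Adj y e) ∨
    (¬ G.Adj y a ∧ G.Adj y b ∧ G.Adj y c ∧ G.Adj y d ∧ ¬ G.Adj y e) ∨
    (G.Adj y a ∧ G.Adj y b ∧ G.Adj y c ∧ ¬ G.Adj y d ∧ ¬ G.Adj y e ∧ ¬ G.Adj y x) ∨
    (¬ G.Adj y a ∧ ¬ G.Adj y b ∧ G.Adj y c ∧ G.Adj y d ∧ G.Adj y e ∧ ¬ G.Adj y x) ∨
    (G.Adj y a ∧ G.Adj y b ∧ G.Adj y c ∧ G.Adj y d ∧ G.Adj y e) := by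
  have p := hG.pattern h y ya yb yd ye
  have t1 := hG.no_false_twin h yc
  have t2 := hG.no_false_twin hx yb
  have b1 := hG.bull_free (a := y) (b := a) (c := b) (d := e) (e := x)
  have q : y ≠ x → _ := fun yx => hG.pattern hx y yx ya yc yd
  obtain ⟨h1, h2, h3, h4, h5, h6, h7, h8, h9, h10⟩ := h
  obtain ⟨k1, -, -, -, k5, k6, k7, -, -, -⟩ := hx
  rcases p with ⟨x1, x2, x3, x4, x5⟩ | ⟨x1, x2, x3, x4, x5⟩ | ⟨x1, x2, x3, x4, x5⟩ |
    ⟨x1, x2, x3, x4, x5⟩ | ⟨x1, x2, x3, x4, x5⟩ | ⟨x1, x2, x3, x4, x5⟩ | ⟨x1, x2, x3, x4, x5⟩ |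
    ⟨x1, x2, x3, x4, x5⟩ | ⟨x1, x2, x3, x4, x5⟩ | ⟨x1, x2, x3, x4, x5⟩ | ⟨x1, x2, x3, x4, x5⟩ |
    ⟨x1, x2, x3, x4, x5⟩ | ⟨x1, x2, x3, x4, x5⟩ <;>
    simp only [x1, x2, x3, x4, x5, not_true, not_false_iff, and_true, and_false, true_and,
      false_and, or_true, or_false, false_or] at q ⊢ <;>
    grind [adj_comm]

/-- An induced path on five vertices that extends to one on six vertices has no centre. -/
theorem IsBasic.no_centre (hG : G.IsBasic) {a b c d e x k₀ : V} (h : G.IsP5 a b c d e)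
    (hx : G.IsP5 x a b c d) (hxe : ¬ G.Adj x e)
    (hk₀ : G.Adj k₀ a ∧ G.Adj k₀ b ∧ G.Adj k₀ c ∧ G.Adj k₀ d ∧ G.Adj k₀ e) : False := by
  let K : Set V := {k | G.Adj k a ∧ G.Adj k b ∧ G.Adj k c ∧ G.Adj k d ∧ G.Adj k e}
  have haK : a ∈ Kᶜ := fun t => t.1.ne rfl
  have hbK : b ∈ Kᶜ := fun t => t.2.1.ne rfl
  have hkx : ∀ k ∈ K, G.Adj k x := by
    rintro k ⟨k1, k2, k3, k4, k5⟩
    by_contra hkx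
    exact hG.bull_free k1 h.ab k2 k4 hx.ab.symm h.ad h.bd hkx hx.reverse.ce hx.reverse.ae
  have hadj : ∀ k ∈ K, ∀ y ∈ Kᶜ, ¬ G.Adj k y →
      ¬ G.Adj y a ∧ ¬ G.Adj y b ∧ ¬ G.Adj y c ∧ ¬ G.Adj y d ∧ ¬ G.Adj y e := by
    intro k hk y hy hky
    have hxk := hkx k hk
    obtain ⟨k1, k2, k3, k4, k5⟩ := hk
    have hyK : ¬ (G.Adj y a ∧ G.Adj y b ∧ G.Adj y c ∧ G.Adj y d ∧ G.Adj y e) := hy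
    have p := hG.pattern_of_extension h hx hxe y (by rintro rfl; exact hky k1)
      (by rintro rfl; exact hky k2) (by rintro rfl; exact hky k3) (by rintro rfl; exact hky k4)
      (by rintro rfl; exact hky k5)
    have b1 := hG.bull_free (a := k) (b := a) (c := b) (d := d) (e := y)
    have b2 := hG.bull_free (a := k) (b := b) (c := c) (d := e) (e := y)
    have b3 := hG.bull_free (a := k) (b := e) (c := d) (d := b) (e := y)
    have b4 := hG.bull_free (a := k) (b := d) (c := c) (d := a) (e := y)
    have b5 := hG.bull_free (a := k) (b := c) (c := d) (d := x) (e := y)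
    have b6 := hG.bull_free (a := k) (b := c) (c := b) (d := x) (e := y)
    have b7 := hG.bull_free (a := k) (b := b) (c := a) (d := e) (e := y)
    clear haK hbK hkx hy hk₀
    obtain ⟨h1, h2, h3, h4, h5, h6, h7, h8, h9, h10⟩ := h
    obtain ⟨m1, -, -, -, m5, m6, m7, -, -, -⟩ := hx
    rcases p with p | ⟨x1, x2, x3, x4, x5⟩ | ⟨x1, x2, x3, x4, x5⟩ |
      ⟨x1, x2, x3, x4, x5⟩ | ⟨x1, x2, x3, x4, x5⟩ | ⟨x1, x2, x3, x4, x5⟩ | ⟨x1, x2, x3, x4, x5⟩ |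
      ⟨x1, x2, x3, x4, x5⟩ | ⟨x1, x2, x3, x4, x5⟩
    · exact p
    all_goals exfalso; grind [adj_comm]
  have hac : a ≠ c := by rintro rfl; exact h.ad h.cd
  have hce : c ≠ e := by rintro rfl; exact h.be h.bc
  let H := G.restrictTo Kᶜ
  have hcomplete : ∀ k ∈ K, ∀ y, H.Reachable a y → G.Adj k y := by
    intro k hk y hy
    by_contra hky
    obtain ⟨u, v, -, ⟨huv, huK, hvK⟩, hu, hv⟩ := hy.exists_adj_and_not (p := G.Adj k) hk.1 hky
    obtain ⟨v1, v2, v3, v4, v5⟩ := hadj k hk v hvK hv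
    rcases hG.pattern_of_adj_away h v1 v2 v3 v4 v5 huv.symm with ⟨u1, u2, u3⟩ | hu'
    · by_cases hua : G.Adj u a
      · exact hG.fork_free hk.2.2.1 hk.2.2.2.2 hu huv hce h.ce (fun t => u2 t.symm)
          (fun t => hG.not_adj_ends h u1 u2 u3 hua t.symm) hv (fun t => v3 t.symm)
          (fun t => v5 t.symm)
      · exact hG.fork_free hk.1 hk.2.2.1 hu huv hac h.ac (fun t => hua t.symm)
          (fun t => u2 t.symm) hv (fun t => v1 t.symm) (fun t => v3 t.symm)
    · exact huK hu'
  have hhom : G.IsHomogeneousSet {u | H.Reachable a u} := by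
    intro y hy
    by_cases hyK : y ∈ K
    · exact Or.inl fun u hu => hcomplete y hyK u hu
    · exact Or.inr fun u hu hyu => hy (Reachable.trans_adj hu
        ⟨hyu.symm, Reachable.mem_of_restrictTo hu haK, hyK⟩)
  have huniv := hG.eq_univ hhom ⟨a, Reachable.refl a, b,
    (show H.Adj a b from ⟨h.ab, haK, hbK⟩).reachable, h.ab.ne⟩
  have hk : k₀ ∈ {u | H.Reachable a u} := huniv ▸ Set.mem_univ k₀
  exact Reachable.mem_of_restrictTo hk haK hk₀

/-- An induced path on six vertices gives a clique cutset. -/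
theorem IsBasic.exists_isCliqueCutset (hG : G.IsBasic) {a b c d e x : V} (h : G.IsP5 a b c d e)
    (hxa : G.Adj x a) (hxb : ¬ G.Adj x b) (hxc : ¬ G.Adj x c) (hxd : ¬ G.Adj x d)
    (hxe : ¬ G.Adj x e) : ∃ Q : Set V, G.IsCliqueCutset Q := by
  have hx : G.IsP5 x a b c d := ⟨hxa, h.ab, h.bc, h.cd, hxb, hxc, hxd, h.ac, h.ad, h.bd⟩
  let Q : Set V :=
    {u | u = c ∨ (¬ G.Adj u a ∧ G.Adj u b ∧ G.Adj u c ∧ G.Adj u d ∧ ¬ G.Adj u e)}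
  have hbQ : b ∉ Q := by
    rintro (t | t)
    · exact h.bc.ne t
    · exact t.2.1.ne rfl
  have hdQ : d ∉ Q := by
    rintro (t | t)
    · exact h.cd.ne t.symm
    · exact t.2.2.2.1.ne rfl
  refine ⟨Q, hG.connected, ?_, fun hcon => ?_⟩
  · rintro u (rfl | ⟨u1, u2, u3, u4, u5⟩) v (rfl | ⟨v1, v2, v3, v4, v5⟩) huv
    · exact absurd rfl huv
    · exact v3.symm
    · exact u3
    · by_contra hadj
      exact hG.no_false_twin (c := v) (x := u)
        ⟨h.ab, v2.symm, v4, h.de, fun t => v1 t.symm, h.ad, h.ae, h.bd, h.be, v5⟩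
        huv u2 u4 u1 hadj u5
  let R : V → Prop := (G.restrictTo (G.awayFrom a b c d e)).Reachable a
  have hRe : ¬ R e := hG.not_reachable h
  have haA : a ∈ G.awayFrom a b c d e := Or.inl rfl
  have heA : e ∈ G.awayFrom a b c d e := Or.inr (Or.inl rfl)
  have hR : ∀ u, R u → u = a ∨ (¬ G.Adj u b ∧ ¬ G.Adj u c ∧ ¬ G.Adj u d ∧ ¬ G.Adj u e) := by
    intro u hu
    rcases hu.mem_of_restrictTo haA with h' | h' | h'
    · exact Or.inl h'
    · exact absurd (h' ▸ hu) hRe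
    · exact Or.inr ⟨h'.1, h'.2.1, h'.2.2, fun t =>
        hRe (hu.trans_adj ⟨t, Or.inr (Or.inr h'), heA⟩)⟩
  have hRstep : ∀ u v, R u → G.Adj u v → ¬ G.Adj v b → ¬ G.Adj v c → ¬ G.Adj v d → R v :=
    fun u v hu huv v1 v2 v3 =>
      hu.trans_adj ⟨huv, hu.mem_of_restrictTo haA, Or.inr (Or.inr ⟨v1, v2, v3⟩)⟩
  let L : V → Prop := fun u => u = b ∨
    (G.Adj u a ∧ G.Adj u b ∧ ¬ G.Adj u d ∧ ¬ G.Adj u e) ∨ R u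
  have hLd : ¬ L d := by
    rintro (t | t | t)
    · exact h.ad (t ▸ h.ab)
    · exact h.ad t.1.symm
    · rcases hR d t with t | t
      · exact h.ac (t ▸ h.cd.symm)
      · exact t.2.2.2 h.de
  have hclosed : ∀ u v, G.Adj u v → v ∉ Q → L u → L v := by
    intro u v huv hvQ hu
    by_contra hv
    have hvR : ¬ R v := fun t => hv (Or.inr (Or.inr t))
    have hvB : ¬ (G.Adj v a ∧ G.Adj v b ∧ ¬ G.Adj v d ∧ ¬ G.Adj v e) := fun t =>
      hv (Or.inr (Or.inl t))
    have hvc : v ≠ c := fun t => hvQ (Or.inl t)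
    have hvF : ¬ (¬ G.Adj v a ∧ G.Adj v b ∧ G.Adj v c ∧ G.Adj v d ∧ ¬ G.Adj v e) := fun t =>
      hvQ (Or.inr t)
    have hva : v ≠ a := by rintro rfl; exact hvR (Reachable.refl _)
    have hvb : v ≠ b := fun t => hv (Or.inl t)
    have hvd : v ≠ d := by
      rintro rfl
      rcases hu with t | t | t
      · exact h.bd (t ▸ huv)
      · exact t.2.2.1 huv
      · rcases hR u t with t | t
        · exact h.ad (t ▸ huv)
        · exact t.2.2.1 huv
    have hve : v ≠ e := by
      rintro rfl
      rcases hu with t | t | t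
      · exact h.be (t ▸ huv)
      · exact t.2.2.2 huv
      · rcases hR u t with t | t
        · exact h.ae (t ▸ huv)
        · exact t.2.2.2 huv
    have hu' : u = b ∨ (G.Adj u a ∧ G.Adj u b ∧ ¬ G.Adj u d ∧ ¬ G.Adj u e) ∨ R u := hu
    have key : (¬ G.Adj v a ∧ ¬ G.Adj v b ∧ ¬ G.Adj v c ∧ ¬ G.Adj v d) ∨
        (¬ G.Adj v a ∧ ¬ G.Adj v b ∧ G.Adj v d ∧ G.Adj v e) := by
      have hvA : G.Adj v a → ¬ G.Adj v b → ¬ G.Adj v c → ¬ G.Adj v d → False :=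
        fun t t1 t2 t3 => hvR (hRstep a v (Reachable.refl _) t.symm t1 t2 t3)
      have hvK := hG.no_centre (k₀ := v) h hx hxe
      rcases hG.pattern_of_extension h hx hxe v hva hvb hvc hvd hve with p | p | p | p | p | p |
        p | p | p
      · exact Or.inl ⟨p.1, p.2.1, p.2.2.1, p.2.2.2.1⟩
      · exact (hvA p.1 p.2.1 p.2.2.1 p.2.2.2.1).elim
      · exact Or.inl ⟨p.1, p.2.1, p.2.2.1, p.2.2.2.1⟩
      · exact (hvB ⟨p.1, p.2.1, p.2.2.2⟩).elim
      · exact Or.inr ⟨p.1, p.2.1, p.2.2.2⟩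
      · exact (hvF p).elim
      · exact (hvB ⟨p.1, p.2.1, p.2.2.2.1, p.2.2.2.2.1⟩).elim
      · exact Or.inr ⟨p.1, p.2.1, p.2.2.2.1, p.2.2.2.2.1⟩
      · exact (hvK p).elim
    rcases hu' with rfl | ⟨ua, ub, ud, ue⟩ | hu'
    · rcases key with k | k
      · exact k.2.1 huv.symm
      · exact k.2.1 huv.symm
    · by_cases uc : G.Adj u c
      · have p := hG.pattern
          (⟨ua.symm, uc, h.cd, h.de, h.ac, h.ad, h.ae, ud, ue, h.ce⟩ : G.IsP5 a u c d e)
          v hva huv.ne' hvd hve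
        simp only [huv.symm, not_true, true_and, false_and, and_false, false_or] at p
        grind
      · rcases key with ⟨k1, k2, k3, k4⟩ | ⟨k1, k2, k3, k4⟩
        · by_cases k5 : G.Adj v e
          · exact hG.not_adj_ends
              (⟨ub, h.bc, h.cd, h.de, uc, ud, ue, h.bd, h.be, h.ce⟩ : G.IsP5 u b c d e)
              k2 k3 k4 huv.symm k5
          · rcases hG.pattern_of_adj_away h k1 k2 k3 k4 k5 huv.symm with t | t
            · exact t.1 ub
            · exact uc t.2.2.1
        · by_cases k5 : G.Adj v c
          · have p := hG.pattern
              (⟨h.ab, h.bc, k5.symm, k4, h.ac, fun t => k1 t.symm, h.ae, fun t => k2 t.symm, h.be,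
                h.ce⟩ : G.IsP5 a b c v e) u ua.ne ub.ne huv.ne (fun t => h.ae (t ▸ ua.symm))
            simp only [huv, ua, ub, not_true, true_and, false_and, and_false, false_or] at p
            grind
          · have p := hG.pattern
              (⟨ub, h.bc, h.cd, h.de, uc, ud, ue, h.bd, h.be, h.ce⟩ : G.IsP5 u b c d e)
              v huv.ne' hvb hvd hve
            simp only [huv.symm, k2, k3, k4, k5, not_true, true_and, false_and, and_false,
              or_false] at p
    · rcases key with ⟨k1, k2, k3, k4⟩ | ⟨k1, k2, k3, k4⟩
      · exact hvR (hRstep u v hu' huv k2 k3 k4)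
      · rcases hR u hu' with rfl | ⟨u2, u3, u4, u5⟩
        · exact k1 huv.symm
        · by_cases u1 : G.Adj u a
          · have p := hG.pattern
              (⟨u1, h.ab, h.bc, h.cd, u2, u3, u4, h.ac, h.ad, h.bd⟩ : G.IsP5 u a b c d)
              v huv.ne' hva hvc hvd
            simp only [huv.symm, k1, k2, k3, not_true, not_false_iff, true_and, false_and,
              and_false, or_false] at p
          · rcases hG.pattern_of_adj_away h u1 u2 u3 u4 u5 huv with t | t
            · exact t.2.2 k3
            · exact k1 t.1
  obtain ⟨u, v, -, huv, hu, hv⟩ := (hcon ⟨b, hbQ⟩ ⟨d, hdQ⟩).exists_adj_and_not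
    (p := fun u => L u.1) (Or.inl rfl) hLd
  exact hv (hclosed u.1 v.1 huv v.2 hu)

/-- Without clique cutsets, `c` sees all vertices but the ends of `a - b - c - d - e`. -/
theorem IsBasic.exists_isCliqueCutset_of_not_adj (hG : G.IsBasic) {a b c d e y : V}
    (h : G.IsP5 a b c d e) (ya : y ≠ a) (yc : y ≠ c) (ye : y ≠ e) (hyc : ¬ G.Adj y c) :
    ∃ Q : Set V, G.IsCliqueCutset Q := by
  have hend := hG.exists_isCliqueCutset h (x := y)
  have hend' := hG.exists_isCliqueCutset h.reverse (x := y)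
  have p := hG.pattern h y ya (by rintro rfl; exact hyc h.bc) (by rintro rfl; exact hyc h.cd.symm)
    ye
  simp only [hyc, not_false_iff, true_and, false_and, and_false, or_false] at p
  rcases p with ⟨p1, p2, p3, p4⟩ | ⟨p1, p2, p3, p4⟩ | ⟨p1, p2, p3, p4⟩ | ⟨p1, p2, p3, p4⟩ |
    ⟨p1, p2, p3, p4⟩ | ⟨p1, p2, p3, p4⟩
  · obtain ⟨x, x2, x3, x4, ⟨x1, x5⟩ | ⟨x1, x5⟩⟩ := hG.exists_end_of_away h p1 p2 hyc p3 p4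
    · exact hG.exists_isCliqueCutset h x1 x2 x3 x4 x5
    · exact hG.exists_isCliqueCutset h.reverse x5 x4 x3 x2 x1
  · exact hend p1 p2 hyc p3 p4
  · exact hend' p4 p3 hyc p2 p1
  · obtain ⟨s, w, hs, w1, w2, w3, w4, w5⟩ := hG.exists_extension h p1 p2 hyc p3 p4
    exact hG.exists_isCliqueCutset hs w1 w2 w3 w4 w5
  · obtain ⟨s, w, hs, w1, w2, w3, w4, w5⟩ := hG.exists_extension h.reverse p4 p3 hyc p2 p1
    exact hG.exists_isCliqueCutset hs w1 w2 w3 w4 w5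
  · exact (hG.no_false_twin h yc p2 p3 p1 hyc p4).elim

/-- If `c` has no non-neighbours besides the nonadjacent vertices `a` and `e`, then some optimal
coloring has the color class `{a, c, e}`. -/
theorem exists_coloring_of_forall_adj [Finite V] {a c e : V} (hac : ¬ G.Adj a c)
    (hae : ¬ G.Adj a e) (hce : ¬ G.Adj c e)
    (h : ∀ y, y ≠ a → y ≠ c → y ≠ e → G.Adj y c) :
    ∃ (k : ℕ) (C : G.Coloring (Fin k)),
      (k : ℕ∞) = G.chromaticNumber ∧ {a, c, e} ∈ C.colorClasses := by
  classical
  obtain ⟨C⟩ := G.colorable_chromaticNumber_of_fintype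
  have hC : ∀ y, C y = C c → y = a ∨ y = c ∨ y = e := by
    intro y hy
    by_contra! hne
    exact C.valid (h y hne.1 hne.2.1 hne.2.2) hy
  let f : V → Fin (ENat.toNat G.chromaticNumber) := fun y => if y = a ∨ y = e then C c else C y
  have hf : ∀ y, f y = C c ↔ y = a ∨ y = c ∨ y = e := by
    intro y
    by_cases hy : y = a ∨ y = e
    · simp only [f, if_pos hy, true_iff]
      tauto
    · simp only [f, if_neg hy]
      exact ⟨hC y, fun t => by rw [show y = c by tauto]⟩
  have hval : ∀ {u v : V}, G.Adj u v → f u ≠ f v := by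
    intro u v huv heq
    by_cases hu : f u = C c
    · have h1 := (hf u).1 hu
      have h2 := (hf v).1 (heq ▸ hu)
      have := huv.symm
      have := huv.ne
      grind [adj_comm]
    · have h1 := mt (hf u).2 hu
      have h2 := mt (hf v).2 (heq ▸ hu)
      simp only [f, if_neg (show ¬ (u = a ∨ u = e) by tauto),
        if_neg (show ¬ (v = a ∨ v = e) by tauto)] at heq
      exact C.valid huv heq
  refine ⟨_, Coloring.mk f hval, ENat.natCast_toNat (chromaticNumber_ne_top_iff_exists.2
    ⟨_, G.colorable_chromaticNumber_of_fintype⟩), c, ?_⟩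
  ext y
  have hfc : f c = C c := (hf c).2 (Or.inr (Or.inl rfl))
  change y = a ∨ y = c ∨ y = e ↔ f y = f c
  rw [hfc, hf]

theorem IsPrimeGraph.isBasic [Finite V] (hprime : G.IsPrimeGraph)
    (hfork : ¬ fork.IsIndContained G) (hbull : ¬ bull.IsIndContained G)
    (hhole : ∀ n : ℕ, 6 ≤ n → ¬ G.HasHole n) {a b c : V} (hab : G.Adj a b) (hac : ¬ G.Adj a c)
    (ne : a ≠ c) : G.IsBasic where
  fork_free h₁ h₂ h₃ h₄ h₅ h₆ h₇ h₈ h₉ h₁₀ h₁₁ :=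
    hfork (fork_isIndContained h₁ h₂ h₃ h₄ h₅ h₆ h₇ h₈ h₉ h₁₀ h₁₁)
  bull_free h₁ h₂ h₃ h₄ h₅ h₆ h₇ h₈ h₉ h₁₀ :=
    hbull (bull_isIndContained h₁ h₂ h₃ h₄ h₅ h₆ h₇ h₈ h₉ h₁₀)
  not_reachable h hr := by
    obtain ⟨n, hn, hn'⟩ := h.exists_hasHole hr
    exact hhole n hn hn'
  connected := { preconnected := hprime.reachable hab, nonempty := ⟨a⟩ }
  eq_univ hS hn := hprime.eq_univ_of_isHomogeneousSet hab ((compl_adj _ _ _).2 ⟨ne, hac⟩) hS hn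

theorem isP5_of_embedding (v : pathGraph 5 ↪g G) : G.IsP5 (v 0) (v 1) (v 2) (v 3) (v 4) := by
  constructor <;> simp [pathGraph_adj]

end SimpleGraph

theorem mainTheorem10 {V : Type*} [Finite V] (G : SimpleGraph V)
    (hprime : G.IsPrimeGraph)
    (hfork : ¬ SimpleGraph.fork.IsIndContained G)
    (hbull : ¬ SimpleGraph.bull.IsIndContained G)
    (hhole : ∀ n : ℕ, 6 ≤ n → ¬ G.HasHole n)
    (v : SimpleGraph.pathGraph 5 ↪g G) :
    (∃ Q : Set V, G.IsCliqueCutset Q) ∨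
      ∃ (k : ℕ) (C : G.Coloring (Fin k)),
        (k : ℕ∞) = G.chromaticNumber ∧ {v 0, v 2, v 4} ∈ C.colorClasses := by
  have h := SimpleGraph.isP5_of_embedding v
  have hG := hprime.isBasic hfork hbull hhole h.ab h.ac (v.injective.ne (by decide))
  by_cases hall : ∀ y, y ≠ v 0 → y ≠ v 2 → y ≠ v 4 → G.Adj y (v 2)
  · exact Or.inr (SimpleGraph.exists_coloring_of_forall_adj h.ac h.ae h.ce hall)
  · push Not at hall
    obtain ⟨y, y0, y2, y4, hy⟩ := hall
    exact Or.inl (hG.exists_isCliqueCutset_of_not_adj h y0 y2 y4 hy)
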